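/- Let $A=\sigma(R)\langle x_1,\dots,x_n\rangle$, $n\ge 1$, be a bijective skew PBW extension of a left noetherian (not necessarily commutative) domain $R$. That is: $R$ is a subring of the ring $A$; the monomials $x_1^{\alpha_1}\cdots x_n^{\alpha_n}$, $\alpha\in\mathbb{N}^n$, form a basis of $A$ as a left $R$-module; for all $i$ and all $0\neq r\in R$ there is $0\neq c_{i,r}\in R$ with $x_ir-c_{i,r}x_i\in R$; for all $i,j$ there is $0\neq c_{i,j}\in R$ with $x_jx_i-c_{i,j}x_ix_j\in R+Rx_1+\cdots+Rx_n$; and, moreover, the maps $\sigma_i:R\to R$ determined by $x_ir-\sigma_i(r)x_i\in R$ $(r\in R)$ are bijective and all $c_{i,j}$ are invertible in $R$. For $f\in A$ let $V(f)$ be the set of all $Z=(z_1,\dots,z_n)\in R^n$ such that $f$ lies in the two-sided ideal of $A$ generated by $x_1-z_1,\dots,x_n-z_n$. Call $X\subseteq R^n$ algebraic if $X=R^n$ or $X\subseteq V(g)$ for some $0\neq g\in A$. Then: (i) There is a topology on $R^n$ (the "Zariski topology") whose closed sets are exactly the algebraic subsets of $R^n$; in particular, finite unions and arbitrary intersections of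 algebraic sets are algebraic. (ii) Every finite subset of $R^n$ is algebraic, and hence closed in this topology. -/

import Mathlib

/-!
Weight the standard monomials by total degree. Moving a variable past a coefficient or past another
variable changes the top-degree part only by a nonzero coefficient, so `x^α · r x^β` is a nonzero
multiple of `x^(α + β)` plus terms of smaller degree. Among the exponents of top degree in two
nonzero elements there is a pair whose sum is attained only once; the product has a nonzero
coefficient there, and so `A` is a domain. Hence `V(f) ∪ V(g) ⊆ V(f g)` with `f g ≠ 0`, which makes
the union of two algebraic sets algebraic, and a point `Z` is contained in `V(x₁ - z₁)`.
-/

open scoped Topology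

namespace SkewPBW

variable {A : Type*} [Ring A] {n : ℕ}

/-- The standard monomial `x^α = x₁^{α₁} ⋯ xₙ^{αₙ}`, the factors being taken in this order. -/
def mon (x : Fin n → A) (α : Fin n → ℕ) : A :=
  (List.ofFn fun i => x i ^ α i).prod

/-- `A` is a skew PBW extension of its subring `R` with respect to `x₁, …, xₙ`,
that is, `A = σ(R)⟨x₁, …, xₙ⟩`. -/
structure IsSkewPBW (R : Subring A) (x : Fin n → A) : Prop where
  /-- The standard monomials are left linearly independent over `R` … -/
  linearIndependent : LinearIndependent R (mon x)
  /-- … and generate `A` as a left `R`-module: they form a basis of `A`, which is free. -/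
  span_eq_top : Submodule.span R (Set.range (mon x)) = ⊤
  /-- For `r ≠ 0` in `R` there is `c ≠ 0` in `R` with `xᵢ r - c xᵢ ∈ R`. -/
  var_mul_coeff : ∀ (i : Fin n) (r : R), r ≠ 0 → ∃ c : R, c ≠ 0 ∧ x i * r - c * x i ∈ R
  /-- There is `c ≠ 0` in `R` with `xⱼ xᵢ - c xᵢ xⱼ ∈ R + R x₁ + ⋯ + R xₙ`. -/
  var_mul_var : ∀ i j : Fin n, ∃ c : R, c ≠ 0 ∧
    x j * x i - c * x i * x j ∈ Submodule.span R (insert 1 (Set.range x))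

/-- The skew PBW extension `A = σ(R)⟨x₁, …, xₙ⟩` is bijective: the maps `σᵢ` are bijective and the
constants `c_{i,j}` are invertible. As the standard monomials form a basis, `σᵢ` and `c_{i,j}` are
determined by the relations that are written here; in particular `σᵢ` is then
automatically a ring endomorphism of `R`. -/
structure IsBijectiveSkewPBW (R : Subring A) (x : Fin n → A) : Prop extends IsSkewPBW R x where
  sigma_bijective : ∀ i : Fin n, ∃ σ : R → R, Function.Bijective σ ∧
    ∀ r : R, x i * r - σ r * x i ∈ R
  isUnit_coeff : ∀ i j : Fin n, ∃ c : R, IsUnit c ∧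
    x j * x i - c * x i * x j ∈ Submodule.span R (insert 1 (Set.range x))

/-- The two-sided ideal `⟨Z⟩ = ⟨x₁ - z₁, …, xₙ - zₙ⟩` of `A`. -/
def pointIdeal {R : Subring A} (x : Fin n → A) (Z : Fin n → R) : TwoSidedIdeal A :=
  TwoSidedIdeal.span (Set.range fun i => x i - (Z i : A))

/-- `Z ∈ Rⁿ` is a root of `f`, written `f(Z) = 0`, if `f ∈ ⟨Z⟩`. -/
def IsRoot {R : Subring A} (x : Fin n → A) (f : A) (Z : Fin n → R) : Prop :=
  f ∈ pointIdeal x Z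

/-- The vanishing set `V(f) ⊆ Rⁿ`. -/
def vanishingSet (R : Subring A) (x : Fin n → A) (f : A) : Set (Fin n → R) :=
  {Z | IsRoot x f Z}

/-- `X ⊆ Rⁿ` is algebraic if `X = Rⁿ` or `X ⊆ V(g)` for some `g ≠ 0` in `A`. -/
def IsAlgebraicSet (R : Subring A) (x : Fin n → A) (X : Set (Fin n → R)) : Prop :=
  X = Set.univ ∨ ∃ g : A, g ≠ 0 ∧ X ⊆ vanishingSet R x g

end SkewPBW

namespace SkewPBW

section LeadingTerm

variable (R : Type*) {A M Γ : Type*} [Semiring R]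

/-- The elements of weight less than `d`: the span of the `b α` with `w α < d`, for a family `b`
(thought of as monomials) whose indices carry weights `w`. -/
def lowerSpan [AddCommMonoid A] [Module R A] [LT Γ] (b : M → A) (w : M → Γ) (d : Γ) :
    Submodule R A :=
  Submodule.span R (b '' {α | w α < d})

/-- `a` has leading term at `α`: it is a nonzero multiple of `b α` plus an element of weight less
than `w α`. Other indices of weight `w α` are not allowed to occur. -/
def HasLeadingTerm [AddCommMonoid A] [Module R A] [LT Γ] (b : M → A) (w : M → Γ) (a : A) (α : M) :
    Prop :=
  ∃ c : R, c ≠ 0 ∧ ∃ l ∈ lowerSpan R b w (w α), a = c • b α + l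

variable {R}

section Module

variable [AddCommMonoid A] [Module R A] {b : M → A} {w : M → Γ}

theorem lowerSpan_mono [Preorder Γ] {d e : Γ} (h : d ≤ e) :
    lowerSpan R b w d ≤ lowerSpan R b w e :=
  Submodule.span_mono (Set.image_mono fun _ hα => lt_of_lt_of_le hα h)

theorem mem_lowerSpan [LT Γ] {α : M} {d : Γ} (h : w α < d) : b α ∈ lowerSpan R b w d :=
  Submodule.subset_span ⟨α, h, rfl⟩

theorem hasLeadingTerm_smul_self [LT Γ] {r : R} (hr : r ≠ 0) (α : M) :
    HasLeadingTerm R b w (r • b α) α :=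
  ⟨r, hr, 0, zero_mem _, (add_zero _).symm⟩

theorem hasLeadingTerm_self [LT Γ] [Nontrivial R] (α : M) : HasLeadingTerm R b w (b α) α := by
  simpa only [one_smul] using hasLeadingTerm_smul_self (R := R) (b := b) (w := w) one_ne_zero α

namespace HasLeadingTerm

theorem mem_lowerSpan [Preorder Γ] {a : A} {α : M} {d : Γ} (h : HasLeadingTerm R b w a α)
    (hd : w α < d) : a ∈ lowerSpan R b w d := by
  obtain ⟨c, -, l, hl, rfl⟩ := h
  exact add_mem (Submodule.smul_mem _ c (SkewPBW.mem_lowerSpan hd)) (lowerSpan_mono hd.le hl)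

theorem add_mem_lowerSpan [LT Γ] {a l : A} {α : M} (h : HasLeadingTerm R b w a α)
    (hl : l ∈ lowerSpan R b w (w α)) : HasLeadingTerm R b w (a + l) α := by
  obtain ⟨c, hc, m, hm, rfl⟩ := h
  exact ⟨c, hc, m + l, add_mem hm hl, add_assoc _ _ _⟩

theorem smul [LT Γ] [NoZeroDivisors R] {a : A} {α : M} (h : HasLeadingTerm R b w a α) {r : R}
    (hr : r ≠ 0) : HasLeadingTerm R b w (r • a) α := by
  obtain ⟨c, hc, l, hl, rfl⟩ := h
  exact ⟨r * c, mul_ne_zero hr hc, r • l, Submodule.smul_mem _ r hl, by rw [smul_add, mul_smul]⟩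

theorem map {A' M' Γ' : Type*} [AddCommMonoid A'] [Module R A'] {b' : M' → A'} {w' : M' → Γ'}
    [LT Γ] [LT Γ'] {a : A} {α : M} {γ : M'} (h : HasLeadingTerm R b w a α) (f : A →+ A')
    (f_lower : ∀ l ∈ lowerSpan R b w (w α), f l ∈ lowerSpan R b' w' (w' γ))
    (f_lead : ∀ c : R, c ≠ 0 → HasLeadingTerm R b' w' (f (c • b α)) γ) :
    HasLeadingTerm R b' w' (f a) γ := by
  obtain ⟨c, hc, l, hl, rfl⟩ := h
  rw [map_add]
  exact (f_lead c hc).add_mem_lowerSpan (f_lower l hl)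

end HasLeadingTerm

theorem repr_eq_zero_of_mem_lowerSpan [Preorder Γ] (b : Module.Basis M R A) {l : A} {d : Γ}
    (hl : l ∈ lowerSpan R b w d) {γ : M} (hγ : d ≤ w γ) : b.repr l γ = 0 := by
  by_contra hne
  exact hγ.not_gt (b.mem_span_image.1 hl (Finsupp.mem_support_iff.2 hne))

theorem HasLeadingTerm.repr_ne_zero [Preorder Γ] {b : Module.Basis M R A} {a : A} {α : M}
    (h : HasLeadingTerm R b w a α) : b.repr a α ≠ 0 := by
  obtain ⟨c, hc, l, hl, rfl⟩ := h
  simpa [repr_eq_zero_of_mem_lowerSpan b hl le_rfl] using hc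

theorem HasLeadingTerm.repr_eq_zero [Preorder Γ] {b : Module.Basis M R A} {a : A} {α γ : M}
    (h : HasLeadingTerm R b w a α) (hw : w α ≤ w γ) (hne : α ≠ γ) : b.repr a γ = 0 := by
  obtain ⟨c, -, l, hl, rfl⟩ := h
  simp [repr_eq_zero_of_mem_lowerSpan b hl hw, Finsupp.single_eq_of_ne' hne]

end Module

theorem exists_uniqueAdd_and_forall_weight_le [AddMonoid M] [UniqueSums M] [AddCommMonoid Γ]
    [LinearOrder Γ] [IsOrderedCancelAddMonoid Γ] (w : M →+ Γ) {S T : Finset M}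
    (hS : S.Nonempty) (hT : T.Nonempty) :
    ∃ α₀ ∈ S, ∃ β₀ ∈ T, UniqueAdd S T α₀ β₀ ∧
      ∀ α ∈ S, ∀ β ∈ T, w (α + β) ≤ w (α₀ + β₀) := by
  obtain ⟨α₁, hα₁, hmaxS⟩ := S.exists_max_image w hS
  obtain ⟨β₁, hβ₁, hmaxT⟩ := T.exists_max_image w hT
  obtain ⟨α₀, hα₀, β₀, hβ₀, huniq⟩ := UniqueSums.uniqueAdd_of_nonempty
    (A := S.filter (w · = w α₁)) (B := T.filter (w · = w β₁))
    ⟨α₁, Finset.mem_filter.2 ⟨hα₁, rfl⟩⟩ ⟨β₁, Finset.mem_filter.2 ⟨hβ₁, rfl⟩⟩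
  obtain ⟨hα₀S, hα₀w⟩ := Finset.mem_filter.1 hα₀
  obtain ⟨hβ₀T, hβ₀w⟩ := Finset.mem_filter.1 hβ₀
  refine ⟨α₀, hα₀S, β₀, hβ₀T, fun α β hα hβ hsum => ?_, fun α hα β hβ => ?_⟩
  · have hw : w α + w β = w α₁ + w β₁ := by
      rw [← map_add, hsum, map_add, hα₀w, hβ₀w]
    obtain ⟨hαw, hβw⟩ := (add_eq_add_iff_eq_and_eq (hmaxS α hα) (hmaxT β hβ)).1 hw
    exact huniq (Finset.mem_filter.2 ⟨hα, hαw⟩) (Finset.mem_filter.2 ⟨hβ, hβw⟩) hsum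
  · rw [map_add, map_add, hα₀w, hβ₀w]
    exact add_le_add (hmaxS α hα) (hmaxT β hβ)

theorem repr_mul [NonUnitalNonAssocSemiring A] [Module R A] [IsScalarTower R A A]
    (b : Module.Basis M R A) (f g : A) (γ : M) :
    b.repr (f * g) γ = ∑ α ∈ (b.repr f).support, ∑ β ∈ (b.repr g).support,
      b.repr (b.repr f α • (b α * b.repr g β • b β)) γ := by
  conv_lhs => rw [← b.linearCombination_repr f, ← b.linearCombination_repr g]
  simp only [Finsupp.linearCombination_apply, Finsupp.sum, Finset.sum_mul_sum, map_sum,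
    Finsupp.finsetSum_apply, smul_mul_assoc]

theorem noZeroDivisors_of_hasLeadingTerm_mul [NoZeroDivisors R] [NonUnitalNonAssocSemiring A]
    [Module R A] [IsScalarTower R A A] [AddMonoid M] [UniqueSums M] [AddCommMonoid Γ]
    [LinearOrder Γ] [IsOrderedCancelAddMonoid Γ] (b : Module.Basis M R A) (w : M →+ Γ)
    (hmul : ∀ (α β : M) (r : R), r ≠ 0 → HasLeadingTerm R b w (b α * r • b β) (α + β)) :
    NoZeroDivisors A := by
  refine ⟨fun {f g} hfg => ?_⟩
  by_contra! hne
  obtain ⟨α₀, hα₀, β₀, hβ₀, huniq, hmax⟩ := exists_uniqueAdd_and_forall_weight_le w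
    (S := (b.repr f).support) (T := (b.repr g).support)
    (by simpa using hne.1) (by simpa using hne.2)
  have hterm : ∀ α ∈ (b.repr f).support, ∀ β ∈ (b.repr g).support,
      HasLeadingTerm R b w (b.repr f α • (b α * b.repr g β • b β)) (α + β) := fun α hα β hβ =>
    (hmul α β _ (Finsupp.mem_support_iff.1 hβ)).smul (Finsupp.mem_support_iff.1 hα)
  have hzero : ∀ α ∈ (b.repr f).support, ∀ β ∈ (b.repr g).support, ¬(α = α₀ ∧ β = β₀) →
      b.repr (b.repr f α • (b α * b.repr g β • b β)) (α₀ + β₀) = 0 := fun α hα β hβ h =>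
    (hterm α hα β hβ).repr_eq_zero (hmax α hα β hβ) fun hsum => h (huniq hα hβ hsum)
  have hcoeff : b.repr (f * g) (α₀ + β₀) =
      b.repr (b.repr f α₀ • (b α₀ * b.repr g β₀ • b β₀)) (α₀ + β₀) := by
    rw [repr_mul, Finset.sum_eq_single_of_mem α₀ hα₀, Finset.sum_eq_single_of_mem β₀ hβ₀]
    · exact fun β hβ hββ₀ => hzero α₀ hα₀ β hβ fun h => hββ₀ h.2
    · exact fun α hα hαα₀ => Finset.sum_eq_zero fun β hβ => hzero α hα β hβ fun h => hαα₀ h.1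
  refine (hterm α₀ hα₀ β₀ hβ₀).repr_ne_zero ?_
  rw [← hcoeff, hfg, map_zero, Finsupp.zero_apply]

end LeadingTerm

section Exponents

variable {n : ℕ}

/-- The total degree of an exponent, as an additive map: the weight that is used for the standard
monomials. -/
def deg : (Fin n → ℕ) →+ ℕ :=
  ∑ i, Pi.evalAddMonoidHom (fun _ => ℕ) i

theorem deg_single (i : Fin n) : deg (Pi.single i 1) = 1 := by
  simp [deg]

theorem exists_le_eq_add_single {α : Fin n → ℕ} {i : Fin n} (hi : α i ≠ 0) :
    ∃ j ≤ i, ∃ β : Fin n → ℕ, α = β + Pi.single j 1 ∧ ∀ k < j, β k = 0 := by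
  obtain ⟨j, hj, hmin⟩ := wellFounded_lt.has_min {j | α j ≠ 0} ⟨i, hi⟩
  refine ⟨j, not_lt.1 (hmin i hi), α - Pi.single j 1, ?_, fun k hk => ?_⟩
  · have hle : Pi.single j 1 ≤ α := by
      intro k
      rcases eq_or_ne k j with rfl | hkj
      · simpa using Nat.one_le_iff_ne_zero.2 hj
      · simp [hkj]
    exact (tsub_add_cancel_of_le hle).symm
  · have hαk : α k = 0 := not_not.1 fun hne => hmin k hne hk
    simp [hαk]

variable {A : Type*} [Ring A]

theorem mon_zero (x : Fin n → A) : mon x 0 = 1 := by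
  simp [mon, List.ofFn_const]

theorem mon_succ (x : Fin (n + 1) → A) (α : Fin (n + 1) → ℕ) :
    mon x α = x 0 ^ α 0 * mon (Fin.tail x) (Fin.tail α) := by
  simp [mon, List.ofFn_succ, Fin.tail]

theorem mon_add_single (x : Fin n → A) {i : Fin n} {α : Fin n → ℕ} (h : ∀ j < i, α j = 0) :
    mon x (α + Pi.single i 1) = x i * mon x α := by
  induction n with
  | zero => exact i.elim0
  | succ n ih =>
    rw [mon_succ, mon_succ]
    cases i using Fin.cases with
    | zero =>
      have htail : Fin.tail (α + Pi.single 0 1) = Fin.tail α := by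
        ext k
        simp [Fin.tail]
      simp [htail, pow_succ', mul_assoc]
    | succ k =>
      have htail : Fin.tail (α + Pi.single k.succ 1) = Fin.tail α + Pi.single k 1 := by
        ext l
        simp [Fin.tail, Pi.single_apply]
      rw [htail, ih (Fin.tail x) (α := Fin.tail α) fun j hj => h j.succ (Fin.succ_lt_succ_iff.2 hj)]
      simp [h 0 k.succ_pos, Fin.tail]

theorem mon_single (x : Fin n → A) (i : Fin n) : mon x (Pi.single i 1) = x i := by
  simpa [mon_zero] using mon_add_single x (i := i) (α := 0) fun _ _ => rfl

end Exponents

theorem mul_mem_of_mem_span {R A : Type*} [Semiring R] [NonUnitalNonAssocSemiring A] [Module R A]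
    [IsScalarTower R A A] {s : Set A} {U : Submodule R A} {a p : A} (h : ∀ y ∈ s, y * a ∈ U)
    (hp : p ∈ Submodule.span R s) : p * a ∈ U :=
  Submodule.span_le (p := U.comap (LinearMap.mulRight R a)).2 h hp

namespace IsSkewPBW

variable {A : Type*} [Ring A] {n : ℕ} {R : Subring A} {x : Fin n → A}

section Commutation

theorem exists_var_mul_smul (hA : IsSkewPBW R x) (i : Fin n) (r : R) :
    ∃ c p : R, (r ≠ 0 → c ≠ 0) ∧ ∀ a : A, x i * r • a = c • (x i * a) + p • a := by
  rcases eq_or_ne r 0 with rfl | hr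
  · exact ⟨0, 0, id, by simp⟩
  · obtain ⟨c, hc, hp⟩ := hA.var_mul_coeff i r hr
    refine ⟨c, ⟨_, hp⟩, fun _ => hc, fun a => ?_⟩
    simp only [Subring.smul_def, smul_eq_mul]
    noncomm_ring

theorem exists_var_mul_var_mul (hA : IsSkewPBW R x) (i j : Fin n) :
    ∃ c : R, c ≠ 0 ∧ ∃ p ∈ Submodule.span R (insert 1 (Set.range x)),
      ∀ a : A, x j * (x i * a) = c • (x i * (x j * a)) + p * a := by
  obtain ⟨c, hc, hp⟩ := hA.var_mul_var i j
  refine ⟨c, hc, _, hp, fun a => ?_⟩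
  simp only [Subring.smul_def, smul_eq_mul]
  noncomm_ring

theorem var_mul_mem_of_mem_span (hA : IsSkewPBW R x) {i : Fin n} {s : Set A}
    {U : Submodule R A} (hU : s ⊆ U) (hxU : ∀ a ∈ s, x i * a ∈ U) {a : A}
    (ha : a ∈ Submodule.span R s) : x i * a ∈ U := by
  induction ha using Submodule.span_induction with
  | mem a ha => exact hxU a ha
  | zero => simp
  | add a b _ _ iha ihb => exact mul_add (x i) a b ▸ add_mem iha ihb
  | smul r a ha ih =>
    obtain ⟨c, p, -, hcomm⟩ := hA.exists_var_mul_smul i r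
    rw [hcomm]
    exact add_mem (U.smul_mem c ih) (U.smul_mem p (Submodule.span_le.2 hU ha))

theorem hasLeadingTerm_var_mul_smul {M Γ : Type*} [LT Γ] {b : M → A} {w : M → Γ}
    [NoZeroDivisors R] (hA : IsSkewPBW R x) {i : Fin n} {a : A} {γ : M}
    (h : HasLeadingTerm R b w (x i * a) γ) (ha : a ∈ lowerSpan R b w (w γ)) {r : R}
    (hr : r ≠ 0) : HasLeadingTerm R b w (x i * r • a) γ := by
  obtain ⟨c, p, hc, hcomm⟩ := hA.exists_var_mul_smul i r
  rw [hcomm]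
  exact (h.smul (hc hr)).add_mem_lowerSpan (Submodule.smul_mem _ p ha)

end Commutation

section Products

theorem var_mul_mem_lowerSpan_of_forall (hA : IsSkewPBW R x) {i : Fin n} {d : ℕ}
    (h : ∀ α, deg α < d → HasLeadingTerm R (mon x) deg (x i * mon x α) (α + Pi.single i 1))
    {a : A} (ha : a ∈ lowerSpan R (mon x) deg d) : x i * a ∈ lowerSpan R (mon x) deg (d + 1) := by
  refine hA.var_mul_mem_of_mem_span ?_ ?_ ha
  · exact Submodule.span_le.1 (lowerSpan_mono d.le_succ)
  · rintro _ ⟨α, hα, rfl⟩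
    exact (h α hα).mem_lowerSpan (by simpa [deg_single] using hα)

variable [IsDomain R]

theorem hasLeadingTerm_var_mul_mon_add_single (hA : IsSkewPBW R x) {i j : Fin n} (hji : j < i)
    {β : Fin n → ℕ} (hβ : ∀ k < j, β k = 0)
    (h : ∀ (k : Fin n) (γ : Fin n → ℕ), deg γ ≤ deg β →
      HasLeadingTerm R (mon x) deg (x k * mon x γ) (γ + Pi.single k 1)) :
    HasLeadingTerm R (mon x) deg (x i * mon x (β + Pi.single j 1))
      (β + Pi.single j 1 + Pi.single i 1) := by
  obtain ⟨c, hc, p, hp, hcomm⟩ := hA.exists_var_mul_var_mul j i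
  rw [add_right_comm, mon_add_single x hβ, hcomm]
  have hlead : HasLeadingTerm R (mon x) deg (x j * mon x (β + Pi.single i 1))
      (β + Pi.single i 1 + Pi.single j 1) := by
    rw [← mon_add_single x fun k hk => by simp [hβ k hk, (hk.trans hji).ne]]
    exact hasLeadingTerm_self _
  have hswap : HasLeadingTerm R (mon x) deg (x j * (x i * mon x β))
      (β + Pi.single i 1 + Pi.single j 1) := by
    refine (h i β le_rfl).map (AddMonoidHom.mulLeft (x j)) (fun l hl => ?_) fun s hs => ?_
    · simp only [map_add, deg_single] at hl ⊢
      exact hA.var_mul_mem_lowerSpan_of_forall (fun γ hγ => h j γ (Nat.lt_succ_iff.1 hγ)) hl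
    · exact hA.hasLeadingTerm_var_mul_smul hlead (mem_lowerSpan (by simp [deg_single])) hs
  refine (hswap.smul hc).add_mem_lowerSpan (mul_mem_of_mem_span ?_ hp)
  rw [Set.forall_mem_insert, Set.forall_mem_range, one_mul]
  exact ⟨mem_lowerSpan (by simp [deg_single]),
    fun k => (h k β le_rfl).mem_lowerSpan (by simp [deg_single])⟩

theorem hasLeadingTerm_var_mul_mon (hA : IsSkewPBW R x) (i : Fin n) (α : Fin n → ℕ) :
    HasLeadingTerm R (mon x) deg (x i * mon x α) (α + Pi.single i 1) := by
  induction hd : deg α using Nat.strong_induction_on generalizing i α with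
  | _ d ih =>
    by_cases hi : ∀ k < i, α k = 0
    · rw [← mon_add_single x hi]
      exact hasLeadingTerm_self _
    · push Not at hi
      obtain ⟨k, hki, hk⟩ := hi
      obtain ⟨j, hjk, β, rfl, hβ⟩ := exists_le_eq_add_single hk
      refine hA.hasLeadingTerm_var_mul_mon_add_single (hjk.trans_lt hki) hβ fun k γ hγ => ?_
      rw [map_add, deg_single] at hd
      exact ih (deg γ) (by omega) k γ rfl

theorem var_mul_mem_lowerSpan (hA : IsSkewPBW R x) (i : Fin n) {d : ℕ} {a : A}
    (ha : a ∈ lowerSpan R (mon x) deg d) : x i * a ∈ lowerSpan R (mon x) deg (d + 1) :=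
  hA.var_mul_mem_lowerSpan_of_forall (fun α _ => hA.hasLeadingTerm_var_mul_mon i α) ha

theorem hasLeadingTerm_var_mul (hA : IsSkewPBW R x) (i : Fin n) {a : A} {α : Fin n → ℕ}
    (h : HasLeadingTerm R (mon x) deg a α) :
    HasLeadingTerm R (mon x) deg (x i * a) (α + Pi.single i 1) := by
  refine h.map (AddMonoidHom.mulLeft (x i)) (fun l hl => ?_) fun c hc => ?_
  · rw [map_add, deg_single]
    exact hA.var_mul_mem_lowerSpan i hl
  · exact hA.hasLeadingTerm_var_mul_smul (hA.hasLeadingTerm_var_mul_mon i α)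
      (mem_lowerSpan (by simp [deg_single])) hc

theorem hasLeadingTerm_mon_mul (hA : IsSkewPBW R x) (α : Fin n → ℕ) {a : A} {β : Fin n → ℕ}
    (h : HasLeadingTerm R (mon x) deg a β) :
    HasLeadingTerm R (mon x) deg (mon x α * a) (α + β) := by
  induction hd : deg α using Nat.strong_induction_on generalizing α with
  | _ d ih =>
    rcases eq_or_ne α 0 with rfl | hα
    · simpa [mon_zero] using h
    · obtain ⟨i, hi⟩ := Function.ne_iff.1 hα
      obtain ⟨j, -, γ, rfl, hγ⟩ := exists_le_eq_add_single hi
      rw [mon_add_single x hγ, mul_assoc, add_right_comm]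
      rw [map_add, deg_single] at hd
      exact hA.hasLeadingTerm_var_mul j (ih (deg γ) (by omega) γ rfl)

end Products

/-- The standard monomials as a basis of `A` over `R`. -/
noncomputable def basis (hA : IsSkewPBW R x) : Module.Basis (Fin n → ℕ) R A :=
  Module.Basis.mk hA.linearIndependent hA.span_eq_top.ge

theorem coe_basis (hA : IsSkewPBW R x) : ⇑hA.basis = mon x :=
  Module.Basis.coe_mk _ _

theorem noZeroDivisors [IsDomain R] (hA : IsSkewPBW R x) : NoZeroDivisors A := by
  refine noZeroDivisors_of_hasLeadingTerm_mul hA.basis deg fun α β r hr => ?_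
  rw [coe_basis]
  exact hA.hasLeadingTerm_mon_mul α (hasLeadingTerm_smul_self hr β)

theorem var_ne_coe [Nontrivial R] (hA : IsSkewPBW R x) (i : Fin n) (z : R) : x i ≠ z := by
  intro h
  have hmon : hA.basis (Pi.single i 1) = z • hA.basis 0 := by
    rw [coe_basis, mon_single, mon_zero, h, Subring.smul_def, smul_eq_mul, mul_one]
  have hne : (0 : Fin n → ℕ) ≠ Pi.single i 1 := (Pi.single_ne_zero_iff.2 one_ne_zero).symm
  simpa [Finsupp.single_eq_of_ne' hne] using
    congrArg (fun a => hA.basis.repr a (Pi.single i 1)) hmon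

end IsSkewPBW

section Zariski

variable {A : Type*} [Ring A] {n : ℕ} {R : Subring A} {x : Fin n → A}

theorem isAlgebraicSet_empty [Nontrivial R] : IsAlgebraicSet R x ∅ :=
  have : Nontrivial A := R.subtype_injective.nontrivial
  Or.inr ⟨1, one_ne_zero, Set.empty_subset _⟩

theorem vanishingSet_union_subset (f g : A) :
    vanishingSet R x f ∪ vanishingSet R x g ⊆ vanishingSet R x (f * g) :=
  Set.union_subset (fun Z hf => (pointIdeal x Z).mul_mem_right f g hf)
    fun Z hg => (pointIdeal x Z).mul_mem_left f g hg

theorem IsAlgebraicSet.union [NoZeroDivisors A] {X Y : Set (Fin n → R)}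
    (hX : IsAlgebraicSet R x X) (hY : IsAlgebraicSet R x Y) : IsAlgebraicSet R x (X ∪ Y) := by
  rcases hX with rfl | ⟨f, hf, hX⟩
  · exact Or.inl (Set.univ_union _)
  rcases hY with rfl | ⟨g, hg, hY⟩
  · exact Or.inl (Set.union_univ _)
  exact Or.inr ⟨f * g, mul_ne_zero hf hg,
    (Set.union_subset_union hX hY).trans (vanishingSet_union_subset f g)⟩

theorem isAlgebraicSet_sInter {S : Set (Set (Fin n → R))}
    (h : ∀ X ∈ S, IsAlgebraicSet R x X) : IsAlgebraicSet R x (⋂₀ S) := by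
  by_cases hS : ∀ X ∈ S, X = Set.univ
  · exact Or.inl (Set.sInter_eq_univ.2 hS)
  · push Not at hS
    obtain ⟨X, hX, hne⟩ := hS
    obtain ⟨g, hg, hXg⟩ := (h X hX).resolve_left hne
    exact Or.inr ⟨g, hg, (Set.sInter_subset_of_mem hX).trans hXg⟩

theorem mem_vanishingSet_var_sub (Z : Fin n → R) (i : Fin n) :
    Z ∈ vanishingSet R x (x i - Z i) :=
  TwoSidedIdeal.subset_span ⟨i, rfl⟩

theorem IsSkewPBW.isAlgebraicSet_singleton [Nontrivial R] (hA : IsSkewPBW R x)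
    (Z : Fin n → R) : IsAlgebraicSet R x {Z} := by
  rcases isEmpty_or_nonempty (Fin n) with _ | ⟨⟨i⟩⟩
  · exact Or.inl (Set.eq_univ_of_forall fun Y => Subsingleton.elim Y Z)
  · exact Or.inr ⟨x i - Z i, sub_ne_zero.2 (hA.var_ne_coe i (Z i)),
      Set.singleton_subset_iff.2 (mem_vanishingSet_var_sub Z i)⟩

/-- The Zariski topology on `Rⁿ`, whose closed sets are the algebraic sets. -/
abbrev zariskiTopology [NoZeroDivisors A] (R : Subring A) [Nontrivial R] (x : Fin n → A) :
    TopologicalSpace (Fin n → R) :=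
  TopologicalSpace.ofClosed {X | IsAlgebraicSet R x X} isAlgebraicSet_empty
    (fun _ hS => isAlgebraicSet_sInter hS) fun _ hX _ hY => hX.union hY

theorem isClosed_zariskiTopology_iff [Nontrivial R] [NoZeroDivisors A] {X : Set (Fin n → R)} :
    IsClosed[zariskiTopology R x] X ↔ IsAlgebraicSet R x X := by
  rw [← @isOpen_compl_iff _ X (zariskiTopology R x)]
  change IsAlgebraicSet R x Xᶜᶜ ↔ _
  rw [compl_compl]

theorem IsSkewPBW.t1Space_zariskiTopology [Nontrivial R] [NoZeroDivisors A]
    (hA : IsSkewPBW R x) : @T1Space _ (zariskiTopology R x) :=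
  letI := zariskiTopology R x
  ⟨fun Z => isClosed_zariskiTopology_iff.2 (hA.isAlgebraicSet_singleton Z)⟩

end Zariski

end SkewPBW

theorem mainTheorem3_general {A : Type*} [Ring A] (R : Subring A) [IsDomain R]
    {n : ℕ} (x : Fin n → A) (hA : SkewPBW.IsSkewPBW R x) :
    (∃ T : TopologicalSpace (Fin n → R),
      (∀ X : Set (Fin n → R), IsClosed[T] X ↔ SkewPBW.IsAlgebraicSet R x X) ∧
      (∀ X : Set (Fin n → R), X.Finite → IsClosed[T] X)) ∧
    (∀ S : Set (Set (Fin n → R)), S.Finite →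
      (∀ X ∈ S, SkewPBW.IsAlgebraicSet R x X) → SkewPBW.IsAlgebraicSet R x (⋃₀ S)) ∧
    (∀ S : Set (Set (Fin n → R)),
      (∀ X ∈ S, SkewPBW.IsAlgebraicSet R x X) → SkewPBW.IsAlgebraicSet R x (⋂₀ S)) ∧
    (∀ X : Set (Fin n → R), X.Finite → SkewPBW.IsAlgebraicSet R x X) := by
  have : NoZeroDivisors A := hA.noZeroDivisors
  let := SkewPBW.zariskiTopology R x
  have : T1Space (Fin n → R) := hA.t1Space_zariskiTopology
  simp only [← SkewPBW.isClosed_zariskiTopology_iff]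
  have hunion : ∀ S : Set (Set (Fin n → R)), S.Finite → (∀ X ∈ S, IsClosed X) → IsClosed (⋃₀ S) :=
    fun S hS h => Set.sUnion_eq_biUnion ▸ hS.isClosed_biUnion h
  exact ⟨⟨SkewPBW.zariskiTopology R x, fun _ => Iff.rfl, fun _ hX => hX.isClosed⟩,
    hunion, fun _ h => isClosed_sInter h, fun _ hX => hX.isClosed⟩

theorem mainTheorem3 {A : Type*} [Ring A] (R : Subring A) [IsDomain R] [IsNoetherianRing R]
    {n : ℕ} (hn : 1 ≤ n) (x : Fin n → A) (hA : SkewPBW.IsBijectiveSkewPBW R x) :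
    (∃ T : TopologicalSpace (Fin n → R),
      (∀ X : Set (Fin n → R), IsClosed[T] X ↔ SkewPBW.IsAlgebraicSet R x X) ∧
      (∀ X : Set (Fin n → R), X.Finite → IsClosed[T] X)) ∧
    (∀ S : Set (Set (Fin n → R)), S.Finite →
      (∀ X ∈ S, SkewPBW.IsAlgebraicSet R x X) → SkewPBW.IsAlgebraicSet R x (⋃₀ S)) ∧
    (∀ S : Set (Set (Fin n → R)),
      (∀ X ∈ S, SkewPBW.IsAlgebraicSet R x X) → SkewPBW.IsAlgebraicSet R x (⋂₀ S)) ∧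
    (∀ X : Set (Fin n → R), X.Finite → SkewPBW.IsAlgebraicSet R x X) := by
  exact mainTheorem3_general R x hA.toIsSkewPBW
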